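/- Multi-armed bandit with constrained feedback. There are $K$ arms, $T$ rounds and a query budget $B\in\mathbb N$. An environment assigns to each round $t\in[T]$ and arm $k\in[K]$ a probability distribution on $[0,1]$ with mean $\mu_t^k$; the rewards $R_t^k$ are drawn independently from these distributions. In each round $t$ a (possibly randomized) algorithm $\mathcal A$ selects an arm $k_t$ and decides whether to query, both on the basis of its internal randomness (independent of the rewards) and of its past decisions and observations; it observes $R_t^{k_t}$ if and only if it queries in round $t$. The algorithm is feasible for the budget $B$ if in every environment it almost surely makes at most $B$ queries in the $T$ rounds. For $V_T\ge 0$ its dynamic regret is $$\mathcal R_T(\mathcal A)=\sup\Big\{\sum_{t=1}^T\max_{k\in[K]}\mu_t^k-\mathbb E\Big[\sum_{t=1}^T\mu_t^{k_t}\Big]\Big\},$$ where the supremum is over all environments whose means satisfy $\sum_{t=1}^{T-1}\sup_{k\in[K]}|\mu_{t+1}^k-\mu_t^k|\le V_T$, and the expectation is over the rewards and the internal randomness. Theorem. There is an absolute constant $c>0$ such that for all integers $K\ge 2$, $T \ge 0$, $B\ge K$, all real $V_T\in[K^{-1},K^{-1}B]$, and every algorithm $\mathcal A$ (which may depend on $K,T,B,V_T$)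 that is feasible for the budget $B$, $$\mathcal R_T(\mathcal A)\;\ge\; c\,\frac{K^{1/3}\,V_T^{1/3}\,T}{B^{1/3}}.$$ -/

import Mathlib

open MeasureTheory

universe u

namespace ConstrainedBandit

/-- A non-stationary bandit environment with `K` arms and horizon `T`: for each round `t` and
arm `k`, the law of the reward `R_t^k`, an arbitrary probability measure on `[0,1]`. -/
abbrev Environment (K T : ℕ) : Type := Fin T → Fin K → ProbabilityMeasure unitInterval

/-- A realization of all the rewards `R_t^k`. -/
abbrev RewardTable (K T : ℕ) : Type := Fin T → Fin K → unitInterval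

/-- What the agent has seen of one round: the arm pulled, whether the reward was queried, and
the reward if it was queried (the third entry is the dummy value `0` if it was not). -/
abbrev Obs (K : ℕ) : Type := Fin K × Bool × unitInterval

namespace Environment

variable {K T : ℕ}

/-- The expected reward `μ_t^k`. -/
noncomputable def mean (E : Environment K T) (t : Fin T) (k : Fin K) : ℝ :=
  ∫ x, (x : ℝ) ∂(E t k : Measure unitInterval)

/-- The optimal expected reward `μ_t^* = max_k μ_t^k`. -/
noncomputable def bestMean (E : Environment K T) (t : Fin T) : ℝ := ⨆ k, E.mean t k

/-- The total variation `∑_{t=1}^{T-1} sup_k |μ_{t+1}^k - μ_t^k|` (rounds are numbered from `0`). -/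
noncomputable def variation (E : Environment K T) : ℝ :=
  ∑ t : Fin (T - 1), ⨆ k, |E.mean ⟨t + 1, by omega⟩ k - E.mean ⟨t, by omega⟩ k|

/-- The joint law of the rewards: all `R_t^k` are independent. -/
noncomputable def rewardLaw (E : Environment K T) : Measure (RewardTable K T) :=
  Measure.pi fun t => Measure.pi fun k => (E t k : Measure unitInterval)

instance (E : Environment K T) : IsProbabilityMeasure E.rewardLaw := by
  unfold rewardLaw; infer_instance

theorem mean_mem (E : Environment K T) (t : Fin T) (k : Fin K) : E.mean t k ∈ Set.Icc 0 1 := by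
  refine ⟨integral_nonneg fun x => x.2.1, ?_⟩
  have h := integral_mono_of_nonneg (μ := (E t k : Measure unitInterval))
    (f := fun x => (x : ℝ)) (g := fun _ => (1 : ℝ))
    (Filter.Eventually.of_forall fun x => x.2.1) (integrable_const _)
    (Filter.Eventually.of_forall fun x => x.2.2)
  simpa [mean] using h

theorem bestMean_le_one (E : Environment K T) (t : Fin T) : E.bestMean t ≤ 1 :=
  Real.iSup_le (fun k => (E.mean_mem t k).2) zero_le_one

end Environment

/-- A possibly randomized algorithm with internal random seed in `Ω`. In each round it chooses, as
a function of its seed and of what it has seen in the previous rounds, an arm to pull and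
whether to query the reward of this round (`true` = query). -/
structure Algorithm (Ω : Type u) [MeasurableSpace Ω] (K T : ℕ) where
  /-- the law of the internal randomness -/
  seedLaw : ProbabilityMeasure Ω
  /-- the decision in round `t` -/
  act : (t : Fin T) → Ω → (Fin t → Obs K) → Fin K × Bool
  measurable_act : ∀ t : Fin T, Measurable fun p : Ω × (Fin t → Obs K) => act t p.1 p.2

namespace Algorithm

variable {Ω : Type u} [MeasurableSpace Ω] {K T : ℕ}

/-- The observations of the first `t` rounds on the sample point `(ω, r)`. -/
def history (A : Algorithm Ω K T) (ω : Ω) (r : RewardTable K T) :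
    (t : ℕ) → t ≤ T → (Fin t → Obs K)
  | 0, _ => fun i => i.elim0
  | t + 1, h =>
    let past := A.history ω r t (Nat.le_of_succ_le h)
    let a := A.act ⟨t, h⟩ ω past
    Fin.snoc (α := fun _ => Obs K) past (a.1, a.2, if a.2 then r ⟨t, h⟩ a.1 else 0)

/-- The decision that the algorithm takes in round `t` on the sample point `(ω, r)`. -/
def decision (A : Algorithm Ω K T) (t : Fin T) (p : Ω × RewardTable K T) : Fin K × Bool :=
  A.act t p.1 (A.history p.1 p.2 t t.2.le)

/-- The arm pulled in round `t`. -/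
def arm (A : Algorithm Ω K T) (t : Fin T) (p : Ω × RewardTable K T) : Fin K := (A.decision t p).1

/-- The number of rounds in which the reward is queried. -/
def numQueries (A : Algorithm Ω K T) (p : Ω × RewardTable K T) : ℕ :=
  ∑ t, if (A.decision t p).2 then 1 else 0

/-- The joint law of the internal randomness and of the rewards, which are independent. -/
noncomputable def sampleLaw (A : Algorithm Ω K T) (E : Environment K T) :
    Measure (Ω × RewardTable K T) :=
  (A.seedLaw : Measure Ω).prod E.rewardLaw

instance (A : Algorithm Ω K T) (E : Environment K T) : IsProbabilityMeasure (A.sampleLaw E) := by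
  unfold sampleLaw; infer_instance

/-- The algorithm respects the query budget `B`: in every environment, almost surely, it makes at
most `B` queries. -/
def Feasible (A : Algorithm Ω K T) (B : ℕ) : Prop :=
  ∀ E : Environment K T, ∀ᵐ p ∂(A.sampleLaw E), A.numQueries p ≤ B

/-- The regret in a given environment: `∑_t μ_t^* - 𝔼[∑_t μ_t^{k_t}]`. -/
noncomputable def regret (A : Algorithm Ω K T) (E : Environment K T) : ℝ :=
  ∑ t, E.bestMean t - ∫ p, ∑ t, E.mean t (A.arm t p) ∂(A.sampleLaw E)

/-- The dynamic regret: the supremum of the regret over the environments whose sequence of means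
has total variation at most `V`. -/
noncomputable def dynamicRegret (A : Algorithm Ω K T) (V : ℝ) : ℝ :=
  ⨆ E : {E : Environment K T // E.variation ≤ V}, A.regret E.1

/-! The integral and the supremum above are those of an integrable function and of a
bounded family. -/

theorem measurable_history (A : Algorithm Ω K T) (t : ℕ) (h : t ≤ T) :
    Measurable fun p : Ω × RewardTable K T => A.history p.1 p.2 t h := by
  induction t with
  | zero => exact measurable_pi_lambda _ fun i => i.elim0
  | succ t ih =>
    have ht := ih (Nat.le_of_succ_le h)
    have ha : Measurable fun p : Ω × RewardTable K T =>
        A.act ⟨t, h⟩ p.1 (A.history p.1 p.2 t (Nat.le_of_succ_le h)) :=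
      (A.measurable_act ⟨t, h⟩).comp (measurable_fst.prodMk ht)
    have hr : Measurable fun p : Ω × RewardTable K T =>
        p.2 ⟨t, h⟩ (A.act ⟨t, h⟩ p.1 (A.history p.1 p.2 t (Nat.le_of_succ_le h))).1 := by
      have hev : Measurable fun q : (Fin K → unitInterval) × Fin K => q.1 q.2 :=
        measurable_from_prod_countable_left fun k => measurable_pi_apply k
      exact hev.comp
        (((measurable_pi_apply _).comp measurable_snd).prodMk ha.fst)
    refine measurable_pi_lambda _ fun i => ?_
    refine Fin.lastCases ?_ (fun j => ?_) i
    · simp only [history, Fin.snoc_last]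
      refine ha.fst.prodMk (ha.snd.prodMk ?_)
      exact Measurable.ite (ha.snd (measurableSet_singleton true)) hr measurable_const
    · simp only [history, Fin.snoc_castSucc]
      exact (measurable_pi_apply j).comp ht

theorem measurable_decision (A : Algorithm Ω K T) (t : Fin T) : Measurable (A.decision t) :=
  (A.measurable_act t).comp (measurable_fst.prodMk (A.measurable_history t t.2.le))

theorem integrable_mean_arm (A : Algorithm Ω K T) (E : Environment K T) (t : Fin T) :
    Integrable (fun p => E.mean t (A.arm t p)) (A.sampleLaw E) := by
  refine Integrable.of_bound (C := 1) ?_ (Filter.Eventually.of_forall fun p => ?_)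
  · exact ((measurable_of_countable (E.mean t)).comp
      (A.measurable_decision t).fst).aestronglyMeasurable
  · rw [Real.norm_eq_abs, abs_of_nonneg (E.mean_mem t _).1]
    exact (E.mean_mem t _).2

theorem regret_le (A : Algorithm Ω K T) (E : Environment K T) : A.regret E ≤ T := by
  have h1 : ∑ t, E.bestMean t ≤ T := by
    simpa using Finset.sum_le_sum fun t (_ : t ∈ Finset.univ) => E.bestMean_le_one t
  have h2 : 0 ≤ ∫ p, ∑ t, E.mean t (A.arm t p) ∂(A.sampleLaw E) :=
    integral_nonneg fun p => Finset.sum_nonneg fun t _ => (E.mean_mem t _).1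
  unfold regret; linarith

theorem bddAbove_regret (A : Algorithm Ω K T) (V : ℝ) :
    BddAbove (Set.range fun E : {E : Environment K T // E.variation ≤ V} => A.regret E.1) :=
  ⟨T, by rintro _ ⟨E, rfl⟩; exact A.regret_le E.1⟩

end Algorithm

end ConstrainedBandit

/-! The hard instances cut the horizon into `m` blocks of consecutive rounds. In block `j` a hidden
arm `θ j` pays a coin of bias `1/2 + Δ` and every other arm a fair coin; regret is `Δ` times the
number of rounds in which the hidden arm is missed. The total variation is at most `Δ (m - 1)`, and
`θ` is averaged over all `K ^ m` choices.

Within a block, compare with the law in which that block is entirely fair. Only queried rewards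
carry information, and each query of the hidden arm contributes relative entropy of order `Δ ^ 2`
(`neg_log_tilt_le`). The comparison law does not depend on `θ j`, so averaging over `θ j` divides
both the pulls and the queries of the hidden arm by `K`: with at most about `q` queries in a block,
the hidden arm is played in a fraction at most `1/K + 1/16 + 64 Δ ^ 2 (q + 1) / K` of its rounds
(`sum_wsum_truncPulls_le`). The change of measure is `wsum_tilt_le`, which handles adaptivity
through the notion `IsLocal`.

The budget is global and may be spent unevenly. A Markov bound takes care of this: pulls are counted
only in blocks with at most `q` queries, and the other blocks are few (`pulls_le`,
`sum_wsum_pulls_le`).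

With `q` of order `B / m` the hidden arms are missed a constant fraction of the time once `B Δ ^ 2`
is at most a small multiple of `K m`. Together with `Δ m` of order `V` this forces `Δ` of order `(K
V / B) ^ (1/3)`, hence regret of order `Δ T`. -/

namespace ConstrainedBandit

/-! ### Adaptive inspection of coordinates -/

section IsLocal

variable {ι X : Type*} [DecidableEq ι]

/-- `f` and the set `S` of inspected coordinates do not depend on the coordinates that are not
inspected. -/
def IsLocal (S : (ι → X) → Finset ι) (f : (ι → X) → ℝ) : Prop :=
  ∀ b i, i ∉ S b → ∀ v, S (Function.update b i v) = S b ∧ f (Function.update b i v) = f b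

theorem IsLocal.mem_update_iff {S : (ι → X) → Finset ι} {f : (ι → X) → ℝ} (h : IsLocal S f)
    (b : ι → X) (i : ι) (v : X) : i ∈ S (Function.update b i v) ↔ i ∈ S b := by
  constructor
  · intro hi
    by_contra hn
    rw [(h b i hn v).1] at hi
    exact hn hi
  · intro hi
    by_contra hn
    have := (h _ i hn (b i)).1
    rw [Function.update_idem, Function.update_eq_self] at this
    rw [this] at hi
    exact hn hi

end IsLocal

/-! ### Finite product measures and change of measure -/

section ProductWeights

variable {ι X : Type*} [Fintype ι] [DecidableEq ι] [Fintype X]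

/-- The expectation of `F` under the product of the weights `w i`. -/
noncomputable def wsum (w : ι → X → ℝ) (F : (ι → X) → ℝ) : ℝ :=
  ∑ b, (∏ i, w i (b i)) * F b

theorem wsum_one {w : ι → X → ℝ} (hw : ∀ i, ∑ v, w i v = 1) : wsum w (fun _ => 1) = 1 := by
  classical
  have h := Finset.prod_univ_sum (fun _ : ι => (Finset.univ : Finset X)) w
  simp only [hw, Finset.prod_const_one, Fintype.piFinset_univ] at h
  simpa [wsum] using h.symm

theorem wsum_const {w : ι → X → ℝ} (hw : ∀ i, ∑ v, w i v = 1) (c : ℝ) :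
    wsum w (fun _ => c) = c := by
  have h := wsum_one hw
  simp only [wsum, mul_one] at h
  rw [wsum, ← Finset.sum_mul, h, one_mul]

theorem wsum_mono {w : ι → X → ℝ} (hw : ∀ i v, 0 ≤ w i v) {F G : (ι → X) → ℝ}
    (h : ∀ b, F b ≤ G b) : wsum w F ≤ wsum w G :=
  Finset.sum_le_sum fun b _ =>
    mul_le_mul_of_nonneg_left (h b) (Finset.prod_nonneg fun i _ => hw i _)

theorem wsum_add (w : ι → X → ℝ) (F G : (ι → X) → ℝ) :
    wsum w (fun b => F b + G b) = wsum w F + wsum w G := by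
  simp [wsum, mul_add, Finset.sum_add_distrib]

theorem wsum_sub (w : ι → X → ℝ) (F G : (ι → X) → ℝ) :
    wsum w (fun b => F b - G b) = wsum w F - wsum w G := by
  simp [wsum, mul_sub, Finset.sum_sub_distrib]

theorem wsum_const_mul (w : ι → X → ℝ) (c : ℝ) (F : (ι → X) → ℝ) :
    wsum w (fun b => c * F b) = c * wsum w F := by
  simp only [wsum, Finset.mul_sum]
  exact Finset.sum_congr rfl fun b _ => by ring

theorem wsum_sum {κ : Type*} (w : ι → X → ℝ) (s : Finset κ) (F : κ → (ι → X) → ℝ) :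
    wsum w (fun b => ∑ k ∈ s, F k b) = ∑ k ∈ s, wsum w (F k) := by
  simp only [wsum, Finset.mul_sum]
  exact Finset.sum_comm

/-- Resampling one coordinate does not change the expectation. -/
theorem wsum_resample {w : ι → X → ℝ} (i : ι) (hw : ∑ v, w i v = 1) (F : (ι → X) → ℝ) :
    wsum w (fun b => ∑ v, w i v * F (Function.update b i v)) = wsum w F := by
  have key : ∀ (b : ι → X) (v : X),
      (∏ l, w l (b l)) * w i v = (∏ l, w l (Function.update b i v l)) * w i (b i) := by
    intro b v
    rw [← Finset.mul_prod_erase _ _ (Finset.mem_univ i),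
      ← Finset.mul_prod_erase _ (fun l => w l (Function.update b i v l)) (Finset.mem_univ i)]
    have : ∏ l ∈ Finset.univ.erase i, w l (Function.update b i v l)
        = ∏ l ∈ Finset.univ.erase i, w l (b l) :=
      Finset.prod_congr rfl fun l hl => by
        rw [Function.update_of_ne (Finset.ne_of_mem_erase hl)]
    rw [this, Function.update_self]
    ring
  have h1 : wsum w (fun b => ∑ v, w i v * F (Function.update b i v))
      = ∑ p : (ι → X) × X, (∏ l, w l (Function.update p.1 i p.2 l)) * w i (p.1 i)
          * F (Function.update p.1 i p.2) := by
    rw [Fintype.sum_prod_type]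
    simp only [wsum, Finset.mul_sum]
    refine Finset.sum_congr rfl fun b _ => Finset.sum_congr rfl fun v _ => ?_
    rw [← key]; ring
  have h2 : wsum w F = ∑ p : (ι → X) × X, (∏ l, w l (p.1 l)) * w i p.2 * F p.1 := by
    rw [Fintype.sum_prod_type]
    refine Finset.sum_congr rfl fun b _ => ?_
    simp only
    rw [← Finset.sum_mul, ← Finset.mul_sum, hw, mul_one]
  rw [h1, h2]
  -- Exchanging the `i`-th coordinate with the fresh value is an involution on pairs, and it matches
  -- the two sums term by term.
  refine Finset.sum_nbij' (fun p => (Function.update p.1 i p.2, p.1 i))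
    (fun p => (Function.update p.1 i p.2, p.1 i)) ?_ ?_ ?_ ?_ ?_ <;> simp

/-- If `Φ b k` does not depend on the coordinate `i` of `b`, then that coordinate may be averaged
separately from the others. -/
theorem sum_diagonal (i : ι) (Φ : (ι → X) → X → ℝ)
    (hΦ : ∀ b v k, Φ (Function.update b i v) k = Φ b k) :
    (Fintype.card X : ℝ) * ∑ b, Φ b (b i) = ∑ b, ∑ k, Φ b k := by
  rcases isEmpty_or_nonempty X with hX | hX
  · have : IsEmpty (ι → X) := ⟨fun b => hX.false (b i)⟩
    simp
  have hc : (Fintype.card X : ℝ) ≠ 0 := by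
    exact_mod_cast Fintype.card_ne_zero
  have h := wsum_resample (w := fun (_ : ι) (_ : X) => (Fintype.card X : ℝ)⁻¹) i
    (by simp [hc]) (fun b => Φ b (b i))
  simp only [wsum, Function.update_self, hΦ, Finset.prod_const, ← Finset.mul_sum] at h
  have h' := mul_left_cancel₀ (pow_ne_zero _ (inv_ne_zero hc)) h
  rw [← h']
  field_simp

/-- An uninspected coordinate influences neither `f` nor `S`, so its factor `g` averages to `1` and
may be dropped. This reduces the full likelihood ratio to that of the inspected data. -/
theorem wsum_mul_prod_of_isLocal {w : ι → X → ℝ} (hw : ∀ i, ∑ v, w i v = 1)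
    (S : (ι → X) → Finset ι) (g : X → ℝ) (J : Finset ι)
    (hg : ∀ i ∈ J, ∑ v, w i v * g v = 1) (f : (ι → X) → ℝ) (hf : IsLocal S f) :
    wsum w (fun b => f b * ∏ i ∈ J, g (b i))
      = wsum w (fun b => f b * ∏ i ∈ J ∩ S b, g (b i)) := by
  induction J using Finset.induction_on generalizing f with
  | empty => simp
  | insert i J hi ih =>
    have hgi := hg i (Finset.mem_insert_self _ _)
    -- The factor at `i` is absorbed into `f` only where `i` is inspected; this keeps the function
    -- local, so the induction hypothesis applies to it.
    set f' : (ι → X) → ℝ := fun b => f b * if i ∈ S b then g (b i) else 1 with hf'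
    have hloc : IsLocal S f' := by
      intro b l hl v
      obtain ⟨h1, h2⟩ := hf b l hl v
      refine ⟨h1, ?_⟩
      simp only [hf', h1, h2]
      split_ifs with h
      · rw [Function.update_of_ne (fun e : i = l => hl (e ▸ h))]
      · rfl
    have h1 := ih (fun l hl => hg l (Finset.mem_insert_of_mem hl)) f' hloc
    have h2 : wsum w (fun b => f' b * ∏ l ∈ J ∩ S b, g (b l))
        = wsum w (fun b => f b * ∏ l ∈ insert i J ∩ S b, g (b l)) := by
      congr 1
      funext b
      by_cases h : i ∈ S b
      · rw [Finset.insert_inter_of_mem h, Finset.prod_insert (by simp [hi])]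
        simp [hf', h, mul_assoc]
      · rw [Finset.insert_inter_of_notMem h]
        simp [hf', h]
    rw [← h2, ← h1, ← sub_eq_zero, ← wsum_sub, ← wsum_resample i (hw i)]
    have h3 : ∀ b : ι → X, ∑ v, w i v *
        (f (Function.update b i v) * ∏ l ∈ insert i J, g (Function.update b i v l)
          - f' (Function.update b i v) * ∏ l ∈ J, g (Function.update b i v l)) = 0 := by
      intro b
      have hp : ∀ v, ∏ l ∈ J, g (Function.update b i v l) = ∏ l ∈ J, g (b l) := fun v =>
        Finset.prod_congr rfl fun l hl => by
          rw [Function.update_of_ne (fun e : l = i => hi (e ▸ hl))]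
      simp only [Finset.prod_insert hi, hp, hf', hf.mem_update_iff, Function.update_self]
      by_cases h : i ∈ S b
      · refine Finset.sum_eq_zero fun v _ => ?_
        simp only [h, if_true]; ring
      · have : ∀ v, w i v * (f (Function.update b i v) * (g v * ∏ l ∈ J, g (b l))
              - f (Function.update b i v) * (if i ∈ S b then g v else 1) * ∏ l ∈ J, g (b l))
            = (f b * ∏ l ∈ J, g (b l)) * (w i v * g v - w i v) := by
          intro v
          simp only [h, if_false, (hf b i h v).2]; ring
        simp only [this]
        rw [← Finset.mul_sum, Finset.sum_sub_distrib, hgi, hw i, sub_self, mul_zero]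
    simp [wsum, h3]

/-- A Wald identity: whether `i` is inspected does not depend on the value at `i`, so each
inspection contributes `κ` on average. Applied to `log g`, it computes the relative entropy of the
observed data. -/
theorem wsum_sum_inter_of_isLocal {w : ι → X → ℝ} (hw : ∀ i, ∑ v, w i v = 1)
    {S : (ι → X) → Finset ι} {f : (ι → X) → ℝ} (hf : IsLocal S f) (φ : X → ℝ) (κ : ℝ)
    (J : Finset ι) (hφ : ∀ i ∈ J, ∑ v, w i v * φ v = κ) :
    wsum w (fun b => ∑ i ∈ J ∩ S b, φ (b i)) = κ * wsum w (fun b => ((J ∩ S b).card : ℝ)) := by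
  have h1 : ∀ ψ : X → ℝ, (fun b : ι → X => ∑ i ∈ J ∩ S b, ψ (b i))
      = fun b => ∑ i ∈ J, if i ∈ S b then ψ (b i) else 0 := by
    intro ψ; funext b
    rw [← Finset.sum_filter, Finset.filter_mem_eq_inter]
  have h2 : (fun b : ι → X => ((J ∩ S b).card : ℝ))
      = fun b => ∑ i ∈ J, if i ∈ S b then 1 else 0 := by
    rw [← h1 fun _ => 1]; simp
  rw [h1, h2, wsum_sum, wsum_sum, Finset.mul_sum]
  refine Finset.sum_congr rfl fun i hi => ?_
  rw [← wsum_resample i (hw i), ← wsum_const_mul]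
  congr 1; funext b
  simp only [hf.mem_update_iff, Function.update_self]
  split_ifs
  · rw [hφ i hi, mul_one]
  · simp

/-- A pointwise substitute for Pinsker's inequality. When `ℓ` is a likelihood ratio, `ℓ - 1` has
mean zero and `ℓ - 1 - log ℓ` averages to the relative entropy. For `ℓ ≤ 1` the left side is
nonpositive, and the right side is nonnegative because `1 - ℓ ≤ 2 (1 - √ℓ) ≤ a + a⁻¹ (1 - √ℓ) ^ 2`
and `(1 - √ℓ) ^ 2 ≤ ℓ - 1 - log ℓ`. -/
theorem mul_sub_one_le_log {f L ℓ a : ℝ} (hf0 : 0 ≤ f) (hfL : f ≤ L) (hℓ : 0 < ℓ) (ha : 0 < a) :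
    f * (ℓ - 1) ≤ L * ((ℓ - 1) + a + a⁻¹ * (ℓ - 1 - Real.log ℓ)) := by
  have hlog : Real.log ℓ ≤ ℓ - 1 := Real.log_le_sub_one_of_pos hℓ
  have hL : 0 ≤ L := hf0.trans hfL
  have hi : 0 < a⁻¹ := inv_pos.mpr ha
  rcases le_total 1 ℓ with h | h
  · calc f * (ℓ - 1) ≤ L * (ℓ - 1) := mul_le_mul_of_nonneg_right hfL (by linarith)
      _ ≤ _ := mul_le_mul_of_nonneg_left
        (by have := mul_nonneg hi.le (sub_nonneg.mpr hlog); linarith) hL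
  · have hs := Real.sq_sqrt hℓ.le
    have hs0 := Real.sqrt_nonneg ℓ
    have hs1 : √ℓ ≤ 1 := Real.sqrt_le_one.mpr h
    have hsp : 0 < √ℓ := Real.sqrt_pos.mpr hℓ
    have hl2 : Real.log ℓ ≤ 2 * (√ℓ - 1) := by
      have h1 := Real.log_le_sub_one_of_pos hsp
      have h2 : Real.log ℓ = 2 * Real.log √ℓ := by
        conv_lhs => rw [← hs, Real.log_pow]
        norm_num
      linarith
    have hq : (1 - √ℓ) ^ 2 ≤ ℓ - 1 - Real.log ℓ := by nlinarith
    have h3 : 1 - ℓ ≤ a + a⁻¹ * (1 - √ℓ) ^ 2 := by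
      have h4 : 1 - ℓ ≤ 2 * (1 - √ℓ) := by nlinarith
      have h5 : a + a⁻¹ * (1 - √ℓ) ^ 2 - 2 * (1 - √ℓ) = a⁻¹ * (a - (1 - √ℓ)) ^ 2 := by
        field_simp; ring
      have := mul_nonneg hi.le (sq_nonneg (a - (1 - √ℓ)))
      linarith
    have h6 := mul_le_mul_of_nonneg_left hq hi.le
    have h7 : f * (ℓ - 1) ≤ 0 := mul_nonpos_of_nonneg_of_nonpos hf0 (by linarith)
    exact h7.trans (mul_nonneg hL (by linarith))

/-- Change of measure: tilting the coordinates in `J` by `g` changes the expectation of a function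
with values in `[0, L]` by a quantity controlled by the expected number of those coordinates that
are inspected. -/
theorem wsum_tilt_le {w w' : ι → X → ℝ} (hw : ∀ i, ∑ v, w i v = 1) (hw0 : ∀ i v, 0 ≤ w i v)
    {S : (ι → X) → Finset ι} {f : (ι → X) → ℝ} (hf : IsLocal S f) {L : ℝ}
    (hf0 : ∀ b, 0 ≤ f b) (hfL : ∀ b, f b ≤ L) (J : Finset ι) (g : X → ℝ) (hg0 : ∀ v, 0 < g v)
    (hg : ∀ i ∈ J, ∑ v, w i v * g v = 1)
    (hw' : ∀ i v, w' i v = w i v * if i ∈ J then g v else 1)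
    {κ a : ℝ} (hκ : ∀ i ∈ J, ∑ v, w i v * Real.log (g v) = -κ) (ha : 0 < a) :
    wsum w' f ≤ wsum w f + L * (a + a⁻¹ * (κ * wsum w (fun b => ((J ∩ S b).card : ℝ)))) := by
  have h1 : ∀ F : (ι → X) → ℝ, wsum w' F = wsum w (fun b => F b * ∏ i ∈ J, g (b i)) := by
    intro F
    refine Finset.sum_congr rfl fun b _ => ?_
    simp only [hw', Finset.prod_mul_distrib]
    rw [Finset.prod_ite_mem, Finset.univ_inter]
    ring
  have hone : IsLocal S (fun _ => (1 : ℝ)) := fun b i hi v => ⟨(hf b i hi v).1, rfl⟩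
  -- The likelihood ratio of the inspected coordinates alone; it has mean `1`, by locality of the
  -- constant function `1`.
  set ℓ : (ι → X) → ℝ := fun b => ∏ i ∈ J ∩ S b, g (b i) with hℓ
  have hw'1 : wsum w ℓ = 1 := by
    have := wsum_mul_prod_of_isLocal hw S g J hg _ hone
    rw [← h1] at this
    simp only [one_mul] at this
    rw [hℓ, ← this]
    refine wsum_one fun i => ?_
    simp only [hw']
    split_ifs with h
    · exact hg i h
    · simpa using hw i
  have hlog : wsum w (fun b => Real.log (ℓ b))
      = -κ * wsum w (fun b => ((J ∩ S b).card : ℝ)) := by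
    rw [← wsum_sum_inter_of_isLocal hw hf (fun v => Real.log (g v)) _ J hκ]
    congr 1; funext b
    exact Real.log_prod fun i _ => (hg0 _).ne'
  rw [h1, wsum_mul_prod_of_isLocal hw S g J hg f hf, ← sub_le_iff_le_add', ← wsum_sub]
  calc wsum w (fun b => f b * ∏ i ∈ J ∩ S b, g (b i) - f b)
      ≤ wsum w (fun b => L * ((ℓ b - 1) + a + a⁻¹ * (ℓ b - 1 - Real.log (ℓ b)))) := by
        refine wsum_mono hw0 fun b => ?_
        have := mul_sub_one_le_log (hf0 b) (hfL b)
          (Finset.prod_pos fun i (_ : i ∈ J ∩ S b) => hg0 (b i)) ha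
        calc _ = f b * (ℓ b - 1) := by simp only [hℓ]; ring
          _ ≤ _ := this
    _ = _ := by
        rw [wsum_const_mul, wsum_add, wsum_add, wsum_const_mul, wsum_sub, wsum_sub, wsum_sub, hlog, hw'1,
          wsum_one hw, wsum_const hw]
        ring

end ProductWeights

/-! ### Decisions depend only on queried rewards -/

namespace Algorithm

variable {Ω : Type u} [MeasurableSpace Ω] {K T : ℕ}

theorem history_congr (A : Algorithm Ω K T) (ω : Ω) {r r' : RewardTable K T} (t : ℕ) (h : t ≤ T)
    (hr : ∀ s : Fin T, (s : ℕ) < t → r s = r' s) : A.history ω r t h = A.history ω r' t h := by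
  induction t with
  | zero => rfl
  | succ t ih =>
    have h1 := ih (Nat.le_of_succ_le h) fun s hs => hr s (hs.trans t.lt_succ_self)
    simp only [history, h1, hr ⟨t, h⟩ t.lt_succ_self]

theorem decision_congr (A : Algorithm Ω K T) (ω : Ω) {r r' : RewardTable K T} (t : Fin T)
    (hr : ∀ s : Fin T, s < t → r s = r' s) : A.decision t (ω, r) = A.decision t (ω, r') := by
  simp only [decision]
  rw [A.history_congr ω _ t.2.le hr]

theorem history_congr_of_not_query (A : Algorithm Ω K T) (ω : Ω) {r r' : RewardTable K T}
    (t : Fin T) (k : Fin K) (hr : ∀ s l, (s, l) ≠ (t, k) → r s l = r' s l)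
    (hd : A.decision t (ω, r) ≠ (k, true)) (n : ℕ) (h : n ≤ T) :
    A.history ω r n h = A.history ω r' n h := by
  induction n with
  | zero => rfl
  | succ n ih =>
    have h1 := ih (Nat.le_of_succ_le h)
    -- The two tables could give different observations only if round `n` were `t` and arm `k` were
    -- queried there, which `hd` excludes.
    have h2 : (if (A.act ⟨n, h⟩ ω (A.history ω r' n (Nat.le_of_succ_le h))).2 then
          r ⟨n, h⟩ (A.act ⟨n, h⟩ ω (A.history ω r' n (Nat.le_of_succ_le h))).1 else 0)
        = if (A.act ⟨n, h⟩ ω (A.history ω r' n (Nat.le_of_succ_le h))).2 then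
          r' ⟨n, h⟩ (A.act ⟨n, h⟩ ω (A.history ω r' n (Nat.le_of_succ_le h))).1 else 0 := by
      split_ifs with hq
      · refine hr _ _ fun e => hd ?_
        simp only [Prod.mk.injEq] at e
        obtain ⟨rfl, e2⟩ := e
        simp only [decision, h1]
        exact Prod.ext e2 hq
      · rfl
    simp only [history, h1, h2]

theorem decision_congr_of_not_query (A : Algorithm Ω K T) (ω : Ω) {r r' : RewardTable K T}
    (t : Fin T) (k : Fin K) (hr : ∀ s l, (s, l) ≠ (t, k) → r s l = r' s l)
    (hd : A.decision t (ω, r) ≠ (k, true)) (s : Fin T) :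
    A.decision s (ω, r) = A.decision s (ω, r') := by
  simp only [decision]
  rw [A.history_congr_of_not_query ω t k hr hd]

end Algorithm

/-! ### Truncated pull counts on binary reward tables -/

/-- The rewards `0` and `1`. -/
def bitReward (v : Bool) : unitInterval := if v then 1 else 0

/-- The reward table with entries `0` and `1` given by `b`. -/
def bitTable {K T : ℕ} (b : Fin T × Fin K → Bool) : RewardTable K T :=
  fun t k => bitReward (b (t, k))

theorem bitTable_update {K T : ℕ} (b : Fin T × Fin K → Bool) (i : Fin T × Fin K) (v : Bool)
    (s : Fin T) (l : Fin K) (h : (s, l) ≠ i) :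
    bitTable (Function.update b i v) s l = bitTable b s l := by
  simp [bitTable, Function.update_of_ne h]

namespace Algorithm

variable {Ω : Type u} [MeasurableSpace Ω] {K T : ℕ}

/-- The number of queries in those rounds that lie in `R` and strictly precede round `n`. -/
def queriesBefore (A : Algorithm Ω K T) (R : Finset (Fin T)) (ω : Ω) (b : Fin T × Fin K → Bool)
    (n : ℕ) : ℕ :=
  (R.filter fun s : Fin T => (s : ℕ) < n ∧ (A.decision s (ω, bitTable b)).2 = true).card

/-- The number of queries in the rounds in `R`. -/
def queriesIn (A : Algorithm Ω K T) (R : Finset (Fin T)) (ω : Ω) (b : Fin T × Fin K → Bool) : ℕ :=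
  (R.filter fun s => (A.decision s (ω, bitTable b)).2 = true).card

/-- The rewards that are queried while there were at most `q` previous queries in the rounds
in `R`. -/
def inspected (A : Algorithm Ω K T) (R : Finset (Fin T)) (q : ℕ) (ω : Ω)
    (b : Fin T × Fin K → Bool) : Finset (Fin T × Fin K) :=
  Finset.univ.filter fun i =>
    A.decision i.1 (ω, bitTable b) = (i.2, true) ∧ A.queriesBefore R ω b i.1 ≤ q

/-- The number of rounds in `R` in which arm `k` is pulled, or `0` if there are more than `q` queries
in these rounds. -/
noncomputable def truncPulls (A : Algorithm Ω K T) (R : Finset (Fin T)) (q : ℕ) (k : Fin K) (ω : Ω)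
    (b : Fin T × Fin K → Bool) : ℝ :=
  if A.queriesIn R ω b ≤ q then
    ((R.filter fun s => (A.decision s (ω, bitTable b)).1 = k).card : ℝ) else 0

theorem queriesBefore_le (A : Algorithm Ω K T) (R : Finset (Fin T)) (ω : Ω)
    (b : Fin T × Fin K → Bool) (n : ℕ) : A.queriesBefore R ω b n ≤ A.queriesIn R ω b :=
  Finset.card_le_card fun s hs => by
    simp only [Finset.mem_filter] at hs ⊢
    exact ⟨hs.1, hs.2.2⟩

theorem queriesBefore_mono (A : Algorithm Ω K T) (R : Finset (Fin T)) (ω : Ω)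
    (b : Fin T × Fin K → Bool) {n m : ℕ} (h : n ≤ m) :
    A.queriesBefore R ω b n ≤ A.queriesBefore R ω b m :=
  Finset.card_le_card fun s hs => by
    simp only [Finset.mem_filter] at hs ⊢
    exact ⟨hs.1, hs.2.1.trans_le h, hs.2.2⟩

theorem decision_update_of_le (A : Algorithm Ω K T) (ω : Ω) (b : Fin T × Fin K → Bool)
    (i : Fin T × Fin K) (v : Bool) (s : Fin T) (hs : s ≤ i.1) :
    A.decision s (ω, bitTable (Function.update b i v)) = A.decision s (ω, bitTable b) :=
  A.decision_congr ω s fun s' hs' => funext fun l => bitTable_update b i v s' l fun e => by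
    rw [← e] at hs
    exact absurd hs' (not_lt.mpr hs)

theorem queriesBefore_update (A : Algorithm Ω K T) (R : Finset (Fin T)) (ω : Ω)
    (b : Fin T × Fin K → Bool) (i : Fin T × Fin K) (v : Bool) (n : ℕ) (hn : n ≤ i.1) :
    A.queriesBefore R ω (Function.update b i v) n = A.queriesBefore R ω b n := by
  unfold queriesBefore
  congr 1
  refine Finset.filter_congr fun s _ => and_congr_right fun hs => ?_
  rw [A.decision_update_of_le ω b i v s (Fin.le_def.mpr (hs.le.trans hn))]

/-- A coordinate is uninspected for one of two reasons. Either it is not queried, and then changing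
it alters no decision; or it is queried after more than `q` queries in `R`, and then the truncated
count is already fixed at `0` whatever follows. -/
theorem isLocal_inspected (A : Algorithm Ω K T) (R : Finset (Fin T)) (q : ℕ) (k : Fin K) (ω : Ω) :
    IsLocal (A.inspected R q ω) (A.truncPulls R q k ω) := by
  intro b i hi v
  by_cases hd : A.decision i.1 (ω, bitTable b) = (i.2, true)
  · have hq : q < A.queriesBefore R ω b i.1 := by
      by_contra h
      exact hi (by simpa [inspected, hd] using h)
    have hq' : q < A.queriesBefore R ω (Function.update b i v) i.1 := by
      rwa [A.queriesBefore_update R ω b i v _ le_rfl]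
    constructor
    · refine Finset.filter_congr fun l _ => ?_
      rcases le_total l.1 i.1 with h | h
      · rw [A.decision_update_of_le ω b i v _ h, A.queriesBefore_update R ω b i v _ h]
      -- From round `i.1` on, the query count exceeds `q` for both tables, so neither inspects
      -- anything more.
      · have h1 := A.queriesBefore_mono R ω b (Fin.le_def.mp h)
        have h2 := A.queriesBefore_mono R ω (Function.update b i v) (Fin.le_def.mp h)
        constructor <;> rintro ⟨-, h3⟩ <;> omega
    · have h1 := A.queriesBefore_le R ω b i.1
      have h2 := A.queriesBefore_le R ω (Function.update b i v) i.1
      rw [truncPulls, truncPulls, if_neg (by omega), if_neg (by omega)]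
  · have h := A.decision_congr_of_not_query ω (r := bitTable b)
      (r' := bitTable (Function.update b i v)) i.1 i.2
      (fun s l hs => (bitTable_update b i v s l hs).symm) hd
    simp only [inspected, truncPulls, queriesBefore, queriesIn, h]
    exact ⟨rfl, rfl⟩

theorem truncPulls_nonneg (A : Algorithm Ω K T) (R : Finset (Fin T)) (q : ℕ) (k : Fin K) (ω : Ω)
    (b : Fin T × Fin K → Bool) : 0 ≤ A.truncPulls R q k ω b := by
  unfold truncPulls; split_ifs <;> positivity

theorem truncPulls_le (A : Algorithm Ω K T) (R : Finset (Fin T)) (q : ℕ) (k : Fin K) (ω : Ω)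
    (b : Fin T × Fin K → Bool) : A.truncPulls R q k ω b ≤ R.card := by
  unfold truncPulls
  split_ifs
  · exact_mod_cast Finset.card_filter_le _ _
  · positivity

theorem sum_truncPulls_le (A : Algorithm Ω K T) (R : Finset (Fin T)) (q : ℕ) (ω : Ω)
    (b : Fin T × Fin K → Bool) : ∑ k, A.truncPulls R q k ω b ≤ R.card := by
  unfold truncPulls
  split_ifs
  · have := Finset.card_eq_sum_card_fiberwise (s := R) (t := Finset.univ)
      (f := fun s => (A.decision s (ω, bitTable b)).1) fun _ _ => Finset.mem_coe.mpr (Finset.mem_univ _)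
    rw [this]
    push_cast
    exact le_rfl
  · simp

/-- Markov's inequality in pointwise form: where the truncation acts, the ratio of queries to `q +
1` is at least `1`. Being linear in the number of queries, the error can be summed over blocks
against the global budget. -/
theorem pulls_le (A : Algorithm Ω K T) (R : Finset (Fin T)) (q : ℕ) (k : Fin K) (ω : Ω)
    (b : Fin T × Fin K → Bool) :
    ((R.filter fun s => (A.decision s (ω, bitTable b)).1 = k).card : ℝ)
      ≤ A.truncPulls R q k ω b + R.card * (A.queriesIn R ω b / (q + 1)) := by
  unfold truncPulls
  split_ifs with h
  · have : (0 : ℝ) ≤ R.card * (A.queriesIn R ω b / (q + 1)) := by positivity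
    linarith
  · have h1 : (1 : ℝ) ≤ A.queriesIn R ω b / (q + 1) := by
      rw [one_le_div (by positivity)]
      exact_mod_cast not_le.mp h
    have h2 : ((R.filter fun s => (A.decision s (ω, bitTable b)).1 = k).card : ℝ) ≤ R.card := by
      exact_mod_cast Finset.card_filter_le _ _
    nlinarith [(Nat.cast_nonneg R.card : (0 : ℝ) ≤ R.card)]

/-- Each round inspects at most one arm, and the last inspecting round in `R` is preceded by at most
`q` queries in `R`; that round itself accounts for the `+ 1`. -/
theorem card_inspected_le (A : Algorithm Ω K T) (R : Finset (Fin T)) (q : ℕ) (ω : Ω)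
    (b : Fin T × Fin K → Bool) :
    ∑ k, (((R ×ˢ {k}) ∩ A.inspected R q ω b).card : ℝ) ≤ q + 1 := by
  set D := R.filter fun s => (A.decision s (ω, bitTable b)).2 = true ∧ A.queriesBefore R ω b s ≤ q
    with hD
  have h1 : ∑ k, ((R ×ˢ {k}) ∩ A.inspected R q ω b).card ≤ D.card := by
    rw [← Finset.card_biUnion]
    · refine Finset.card_le_card_of_injOn Prod.fst ?_ ?_
      · rintro ⟨t, l⟩ hi
        simp only [Finset.coe_biUnion, Set.mem_iUnion, Finset.mem_coe, Finset.mem_inter,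
          Finset.mem_product, inspected, Finset.mem_filter] at hi
        obtain ⟨k, -, ⟨hR, -⟩, -, h3, h4⟩ := hi
        simp only [hD, Finset.mem_coe, Finset.mem_filter]
        exact ⟨hR, by rw [h3], h4⟩
      · rintro ⟨t, l⟩ hi ⟨t', l'⟩ hi' (rfl : t = t')
        simp only [Finset.coe_biUnion, Set.mem_iUnion, Finset.mem_coe, Finset.mem_inter,
          Finset.mem_product, inspected, Finset.mem_filter] at hi hi'
        obtain ⟨k, -, -, -, h3, -⟩ := hi
        obtain ⟨k', -, -, -, h3', -⟩ := hi'
        rw [h3] at h3'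
        simp only [Prod.mk.injEq] at h3'
        rw [h3'.1]
    · intro k _ k' _ hk
      refine Finset.disjoint_left.mpr fun i hi hi' => hk ?_
      simp only [Finset.mem_inter, Finset.mem_product, Finset.mem_singleton] at hi hi'
      rw [← hi.1.2, hi'.1.2]
  have h2 : D.card ≤ q + 1 := by
    rcases D.eq_empty_or_nonempty with h | h
    · simp [h]
    · have hm := D.max'_mem h
      set s := D.max' h
      have h3 : D ⊆ insert s
          (R.filter fun s' : Fin T => (s' : ℕ) < s ∧ (A.decision s' (ω, bitTable b)).2 = true) := by
        intro s' hs'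
        rw [Finset.mem_insert, or_iff_not_imp_left]
        intro hne
        have hlt := lt_of_le_of_ne (D.le_max' s' hs') hne
        simp only [hD, Finset.mem_filter] at hs' ⊢
        exact ⟨hs'.1, hlt, hs'.2.1⟩
      have h4 := (Finset.card_le_card h3).trans (Finset.card_insert_le _ _)
      have h5 : A.queriesBefore R ω b s ≤ q := by
        simp only [hD, Finset.mem_filter] at hm
        exact hm.2.2
      exact h4.trans (Nat.succ_le_succ h5)
  exact_mod_cast h1.trans h2

end Algorithm

/-! ### Bernoulli environments as finite weighted sums -/

variable {K T : ℕ}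

/-- The weights of the two outcomes of a coin with bias `p`. -/
def coinWeight (p : ℝ) (v : Bool) : ℝ := if v then p else 1 - p

theorem sum_coinWeight (p : ℝ) : ∑ v, coinWeight p v = 1 := by simp [coinWeight]

theorem coinWeight_nonneg {p : ℝ} (h0 : 0 ≤ p) (h1 : p ≤ 1) (v : Bool) : 0 ≤ coinWeight p v := by
  cases v <;> simp [coinWeight, h0, h1]

/-- The law of a coin with bias `p`. -/
noncomputable def coinLaw (p : unitInterval) : Measure Bool :=
  ENNReal.ofReal p • Measure.dirac true + ENNReal.ofReal (1 - p) • Measure.dirac false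

theorem coinLaw_singleton (p : unitInterval) (v : Bool) :
    coinLaw p {v} = ENNReal.ofReal (coinWeight p v) := by
  cases v <;> simp [coinLaw, coinWeight]

instance (p : unitInterval) : IsProbabilityMeasure (coinLaw p) := by
  constructor
  simp only [coinLaw, Measure.coe_add, Measure.coe_smul, Pi.add_apply, Pi.smul_apply,
    measure_univ, smul_eq_mul, mul_one]
  rw [← ENNReal.ofReal_add p.2.1 (sub_nonneg.mpr p.2.2)]
  simp

theorem measurable_bitReward : Measurable bitReward := measurable_of_countable _

/-- The environment in which all rewards are `0` or `1`, with means `p t k`. -/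
noncomputable def coinEnv (p : Fin T → Fin K → unitInterval) : Environment K T := fun t k =>
  ⟨(coinLaw (p t k)).map bitReward,
    Measure.isProbabilityMeasure_map measurable_bitReward.aemeasurable⟩

theorem coinEnv_mean (p : Fin T → Fin K → unitInterval) (t : Fin T) (k : Fin K) :
    (coinEnv p).mean t k = p t k := by
  have h : (coinEnv p).mean t k = ∫ v, (bitReward v : ℝ) ∂(coinLaw (p t k)) := by
    refine integral_map measurable_bitReward.aemeasurable ?_
    exact measurable_subtype_coe.aestronglyMeasurable
  rw [h, integral_fintype (.of_finite)]
  simp [measureReal_def, coinLaw_singleton, bitReward, coinWeight, (p t k).2.1]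

/-- The weights of the reward tables in `coinEnv p`. -/
noncomputable def tableWeight (p : Fin T → Fin K → unitInterval) (i : Fin T × Fin K) (v : Bool) :
    ℝ := coinWeight (p i.1 i.2) v

theorem coinEnv_rewardLaw (p : Fin T → Fin K → unitInterval) :
    (coinEnv p).rewardLaw = (Measure.pi fun t => Measure.pi fun k => coinLaw (p t k)).map
      fun c t k => bitReward (c t k) := by
  have h1 : ∀ t, (Measure.pi fun k => (coinEnv p t k : Measure unitInterval))
      = (Measure.pi fun k => coinLaw (p t k)).map fun c k => bitReward (c k) := fun t =>
    (Measure.pi_map_pi fun k => measurable_bitReward.aemeasurable).symm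
  have h2 : Measurable fun (c : Fin K → Bool) k => bitReward (c k) := measurable_of_countable _
  unfold Environment.rewardLaw
  simp only [h1]
  have : ∀ t, IsProbabilityMeasure
      ((Measure.pi fun k => coinLaw (p t k)).map fun c k => bitReward (c k)) := fun t =>
    Measure.isProbabilityMeasure_map h2.aemeasurable
  exact (Measure.pi_map_pi fun t => h2.aemeasurable).symm

theorem pi_coinLaw_singleton (p : Fin T → Fin K → unitInterval) (c : Fin T → Fin K → Bool) :
    (Measure.pi fun t => Measure.pi fun k => coinLaw (p t k)) {c}
      = ENNReal.ofReal (∏ i : Fin T × Fin K, tableWeight p i (c i.1 i.2)) := by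
  simp only [Measure.pi_singleton, coinLaw_singleton]
  rw [ENNReal.ofReal_prod_of_nonneg fun i _ =>
    coinWeight_nonneg (p i.1 i.2).2.1 (p i.1 i.2).2.2 _, Fintype.prod_prod_type]
  rfl

theorem integral_coinEnv (p : Fin T → Fin K → unitInterval) {F : RewardTable K T → ℝ}
    (hF : Measurable F) :
    ∫ r, F r ∂(coinEnv p).rewardLaw = wsum (tableWeight p) fun b => F (bitTable b) := by
  rw [coinEnv_rewardLaw, integral_map (measurable_of_countable _).aemeasurable
    hF.aestronglyMeasurable, integral_fintype (.of_finite)]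
  unfold wsum
  refine Fintype.sum_equiv (Equiv.curry (Fin T) (Fin K) Bool).symm _ _ fun c => ?_
  rw [measureReal_def, pi_coinLaw_singleton, ENNReal.toReal_ofReal]
  · rfl
  · exact Finset.prod_nonneg fun i _ => coinWeight_nonneg (p i.1 i.2).2.1 (p i.1 i.2).2.2 _

/-- With biases strictly between `0` and `1` every binary table has positive mass, so an almost sure
property holds on all of them. The budget constraint thereby becomes a statement about tables that
no longer refers to the environment. -/
theorem forall_bitTable_of_ae (p : Fin T → Fin K → unitInterval) (hp0 : ∀ t k, 0 < (p t k : ℝ))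
    (hp1 : ∀ t k, (p t k : ℝ) < 1) {Q : RewardTable K T → Prop}
    (h : ∀ᵐ r ∂(coinEnv p).rewardLaw, Q r) (b : Fin T × Fin K → Bool) : Q (bitTable b) := by
  rw [coinEnv_rewardLaw] at h
  have h' := ae_of_ae_map (measurable_of_countable _).aemeasurable h
  by_contra hn
  have h0 := measure_mono_null (s := {fun t k => b (t, k)})
    (Set.singleton_subset_iff.mpr hn) h'
  rw [pi_coinLaw_singleton, ENNReal.ofReal_eq_zero] at h0
  refine absurd h0 (not_le.mpr (Finset.prod_pos fun i _ => ?_))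
  simp only [tableWeight, coinWeight]
  split_ifs
  · exact hp0 _ _
  · exact sub_pos.mpr (hp1 _ _)

namespace Algorithm

variable {Ω : Type u} [MeasurableSpace Ω]

theorem ae_numQueries_bitTable_le (A : Algorithm Ω K T) {B : ℕ} (hA : A.Feasible B)
    (p : Fin T → Fin K → unitInterval) (hp0 : ∀ t k, 0 < (p t k : ℝ))
    (hp1 : ∀ t k, (p t k : ℝ) < 1) :
    ∀ᵐ ω ∂(A.seedLaw : Measure Ω), ∀ b, A.numQueries (ω, bitTable b) ≤ B := by
  have h := Measure.ae_ae_of_ae_prod (hA (coinEnv p))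
  filter_upwards [h] with ω hω b
  exact forall_bitTable_of_ae p hp0 hp1 hω b

theorem integrable_wsum_mean_arm (A : Algorithm Ω K T) (p : Fin T → Fin K → unitInterval) :
    Integrable (fun ω => wsum (tableWeight p) fun b => ∑ t, (p t (A.arm t (ω, bitTable b)) : ℝ))
        (A.seedLaw : Measure Ω) ∧
      ∫ x, ∑ t, (coinEnv p).mean t (A.arm t x) ∂(A.sampleLaw (coinEnv p))
        = ∫ ω, wsum (tableWeight p) (fun b => ∑ t, (p t (A.arm t (ω, bitTable b)) : ℝ))
          ∂(A.seedLaw : Measure Ω) := by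
  have hint : Integrable (fun x => ∑ t, (coinEnv p).mean t (A.arm t x))
      ((A.seedLaw : Measure Ω).prod (coinEnv p).rewardLaw) :=
    integrable_finsetSum _ fun t _ => A.integrable_mean_arm (coinEnv p) t
  have hmeas : Measurable fun x => ∑ t, (coinEnv p).mean t (A.arm t x) :=
    Finset.measurable_sum _ fun t _ =>
      (measurable_of_countable ((coinEnv p).mean t)).comp (A.measurable_decision t).fst
  have heq : ∀ ω, ∫ r, ∑ t, (coinEnv p).mean t (A.arm t (ω, r)) ∂(coinEnv p).rewardLaw
      = wsum (tableWeight p) fun b => ∑ t, (p t (A.arm t (ω, bitTable b)) : ℝ) := by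
    intro ω
    have h := integral_coinEnv p (hmeas.comp (measurable_prodMk_left (x := ω)))
    simpa only [Function.comp_apply, coinEnv_mean] using h
  constructor
  · simpa only [heq] using hint.integral_prod_left
  · rw [sampleLaw, integral_prod _ hint]
    simp only [heq]

end Algorithm

/-! ### Hidden good arm in each block -/

variable {m : ℕ}

/-- The weights of the reward tables in which arm `θ (β t)` has bias `1 / 2 + Δ` in round `t` and
the other arms have bias `1 / 2`. -/
noncomputable def blockWeight (Δ : ℝ) (β : Fin T → Fin m) (θ : Fin m → Fin K)
    (i : Fin T × Fin K) (v : Bool) : ℝ :=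
  coinWeight (1 / 2 + if i.2 = θ (β i.1) then Δ else 0) v

/-- As `blockWeight`, but with bias `1 / 2` for all the arms in block `j`. -/
noncomputable def flatWeight (Δ : ℝ) (β : Fin T → Fin m) (j : Fin m) (θ : Fin m → Fin K)
    (i : Fin T × Fin K) (v : Bool) : ℝ :=
  coinWeight (1 / 2 + if β i.1 ≠ j ∧ i.2 = θ (β i.1) then Δ else 0) v

/-- The comparison law does not see the hidden arm of block `j`; this is what allows `sum_diagonal`
to average over that arm separately. -/
theorem flatWeight_update (Δ : ℝ) (β : Fin T → Fin m) (j : Fin m) (θ : Fin m → Fin K)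
    (k : Fin K) : flatWeight Δ β j (Function.update θ j k) = flatWeight Δ β j θ := by
  funext i v
  unfold flatWeight
  by_cases h : β i.1 = j
  · simp [h]
  · rw [Function.update_of_ne h]

/-- The rounds of block `j`. -/
def blockRounds (β : Fin T → Fin m) (j : Fin m) : Finset (Fin T) :=
  Finset.univ.filter fun t => β t = j

/-- The left side is the relative entropy of a fair coin with respect to one of bias `1/2 + Δ`,
which equals `-(1/2) log (1 - 4 Δ ^ 2)`. -/
theorem neg_log_tilt_le {Δ : ℝ} (h0 : 0 ≤ Δ) (h1 : Δ ≤ 1 / 4) :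
    -(1 / 2 * Real.log (1 + 2 * Δ) + 1 / 2 * Real.log (1 - 2 * Δ)) ≤ 4 * Δ ^ 2 := by
  have hΔ : Δ ^ 2 ≤ 1 / 16 := by nlinarith
  have hp : (0 : ℝ) < 1 - 4 * Δ ^ 2 := by linarith
  have h2 : Real.log (1 + 2 * Δ) + Real.log (1 - 2 * Δ) = Real.log (1 - 4 * Δ ^ 2) := by
    rw [← Real.log_mul (by linarith) (by linarith)]
    congr 1; ring
  have h3 := Real.one_sub_inv_le_log_of_pos hp
  have h4 : (1 - 4 * Δ ^ 2)⁻¹ ≤ 1 + 8 * Δ ^ 2 := by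
    rw [inv_le_iff_one_le_mul₀ hp]
    nlinarith [sq_nonneg Δ, mul_nonneg (sq_nonneg Δ) (sub_nonneg.mpr hΔ)]
  linarith

namespace Algorithm

variable {Ω : Type u} [MeasurableSpace Ω]

/-- This is `wsum_tilt_le` with the flat law as base, density `1 ± 2 Δ` on the rewards of the hidden
arm in block `j`, and `a = 1/16`, so that `64 = 16 * 4` with the `4` from `neg_log_tilt_le`. The
expected inspections are thus those under the flat law. -/
theorem wsum_blockWeight_truncPulls_le (A : Algorithm Ω K T) {Δ : ℝ} (h0 : 0 ≤ Δ) (h1 : Δ ≤ 1 / 4)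
    (β : Fin T → Fin m) (j : Fin m) (θ : Fin m → Fin K) (q : ℕ) (ω : Ω) :
    wsum (blockWeight Δ β θ) (A.truncPulls (blockRounds β j) q (θ j) ω)
      ≤ wsum (flatWeight Δ β j θ) (A.truncPulls (blockRounds β j) q (θ j) ω)
        + (blockRounds β j).card * (1 / 16 + 64 * Δ ^ 2 * wsum (flatWeight Δ β j θ) fun b =>
          (((blockRounds β j ×ˢ {θ j}) ∩ A.inspected (blockRounds β j) q ω b).card : ℝ)) := by
  have hw0 : ∀ i v, 0 ≤ flatWeight Δ β j θ i v := fun i v => by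
    refine coinWeight_nonneg ?_ ?_ v <;> split_ifs <;> linarith
  have hJ : ∀ i ∈ blockRounds β j ×ˢ {θ j}, ∀ v, flatWeight Δ β j θ i v = 1 / 2 := by
    intro i hi v
    simp only [blockRounds, Finset.mem_product, Finset.mem_filter, Finset.mem_univ,
      true_and] at hi
    unfold flatWeight coinWeight
    simp only [hi.1, ne_eq, not_true_eq_false, false_and, if_false]
    cases v <;> norm_num
  have h := wsum_tilt_le (w := flatWeight Δ β j θ) (w' := blockWeight Δ β θ)
    (fun i => sum_coinWeight _) hw0 (A.isLocal_inspected (blockRounds β j) q (θ j) ω)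
    (A.truncPulls_nonneg _ _ _ ω) (A.truncPulls_le _ _ _ ω) (blockRounds β j ×ˢ {θ j})
    (fun v => if v then 1 + 2 * Δ else 1 - 2 * Δ)
    (fun v => by cases v <;> simp <;> linarith)
    (fun i hi => by simp only [hJ i hi, Fintype.sum_bool]; simp; ring)
    (fun i v => by
      by_cases hi : i ∈ blockRounds β j ×ˢ {θ j}
      · rw [hJ i hi v, if_pos hi]
        simp only [blockRounds, Finset.mem_product, Finset.mem_filter, Finset.mem_univ,
          true_and, Finset.mem_singleton] at hi
        unfold blockWeight coinWeight
        rw [hi.1, if_pos hi.2]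
        cases v <;> simp <;> ring
      · rw [if_neg hi, mul_one]
        simp only [blockRounds, Finset.mem_product, Finset.mem_filter, Finset.mem_univ,
          true_and, Finset.mem_singleton] at hi
        unfold blockWeight flatWeight
        congr 3
        by_cases hb : β i.1 = j
        · have : i.2 ≠ θ j := fun e => hi ⟨hb, e⟩
          simp [hb, this]
        · simp [hb])
    (κ := -(1 / 2 * Real.log (1 + 2 * Δ) + 1 / 2 * Real.log (1 - 2 * Δ))) (a := 1 / 16)
    (fun i hi => by simp only [hJ i hi, Fintype.sum_bool]; simp) (by norm_num)
  refine h.trans ?_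
  set N := wsum (flatWeight Δ β j θ) fun b =>
    (((blockRounds β j ×ˢ {θ j}) ∩ A.inspected (blockRounds β j) q ω b).card : ℝ)
  have hN : 0 ≤ N := Finset.sum_nonneg fun b _ =>
    mul_nonneg (Finset.prod_nonneg fun i _ => hw0 i _) (Nat.cast_nonneg _)
  have h2 := mul_le_mul_of_nonneg_right (neg_log_tilt_le h0 h1) hN
  have h3 : (1 / 16 : ℝ)⁻¹ = 16 := by norm_num
  rw [h3, show 64 * Δ ^ 2 * N = 16 * (4 * Δ ^ 2 * N) by ring]
  gcongr

/-- Under the flat law of block `j` the truncated pulls of all arms sum to at most the block length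
and the inspections to at most `q + 1`. A uniformly chosen `θ j` receives a `1/K` share of each. -/
theorem sum_wsum_truncPulls_le (A : Algorithm Ω K T) (hK : 0 < K) {Δ : ℝ} (h0 : 0 ≤ Δ)
    (h1 : Δ ≤ 1 / 4) (β : Fin T → Fin m) (j : Fin m) (q : ℕ) (ω : Ω) :
    ∑ θ : Fin m → Fin K,
        wsum (blockWeight Δ β θ) (A.truncPulls (blockRounds β j) q (θ j) ω)
      ≤ (K : ℝ) ^ m * ((blockRounds β j).card
          * (1 / K + 1 / 16 + 64 * Δ ^ 2 * (q + 1) / K)) := by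
  set R := blockRounds β j
  set Φ : (Fin m → Fin K) → Fin K → ℝ := fun θ k =>
    wsum (flatWeight Δ β j θ) (A.truncPulls R q k ω)
      + R.card * (1 / 16 + 64 * Δ ^ 2 * wsum (flatWeight Δ β j θ) fun b =>
        (((R ×ˢ {k}) ∩ A.inspected R q ω b).card : ℝ)) with hΦ
  have hK' : (0 : ℝ) < K := by exact_mod_cast hK
  have hdiag := sum_diagonal j Φ fun θ v k => by simp only [hΦ, flatWeight_update]
  rw [Fintype.card_fin] at hdiag
  have hstep : ∀ θ, ∑ k, Φ θ k ≤ R.card * (1 + K / 16 + 64 * Δ ^ 2 * (q + 1)) := by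
    intro θ
    have hw : ∀ i, ∑ v, flatWeight Δ β j θ i v = 1 := fun i => sum_coinWeight _
    have hw0 : ∀ i v, 0 ≤ flatWeight Δ β j θ i v := fun i v => by
      refine coinWeight_nonneg ?_ ?_ v <;> split_ifs <;> linarith
    have e1 : ∑ k, wsum (flatWeight Δ β j θ) (A.truncPulls R q k ω) ≤ R.card := by
      rw [← wsum_sum]
      exact (wsum_mono hw0 fun b => A.sum_truncPulls_le R q ω b).trans_eq (wsum_const hw _)
    have e2 : ∑ k, wsum (flatWeight Δ β j θ)
        (fun b => (((R ×ˢ {k}) ∩ A.inspected R q ω b).card : ℝ)) ≤ q + 1 := by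
      rw [← wsum_sum]
      exact (wsum_mono hw0 fun b => A.card_inspected_le R q ω b).trans_eq (wsum_const hw _)
    simp only [hΦ, Finset.sum_add_distrib, ← Finset.mul_sum, Finset.sum_const, Finset.card_univ,
      Fintype.card_fin, nsmul_eq_mul]
    have e3 := mul_le_mul_of_nonneg_left e2 (by positivity : 0 ≤ 64 * Δ ^ 2)
    have e4 := mul_le_mul_of_nonneg_left e3 (Nat.cast_nonneg R.card : (0 : ℝ) ≤ R.card)
    linarith
  have hsum : (K : ℝ) * ∑ θ, Φ θ (θ j)
      ≤ (K : ℝ) ^ m * (R.card * (1 + K / 16 + 64 * Δ ^ 2 * (q + 1))) := by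
    rw [hdiag]
    refine (Finset.sum_le_sum fun θ _ => hstep θ).trans_eq ?_
    simp
  calc _ ≤ ∑ θ, Φ θ (θ j) := Finset.sum_le_sum fun θ _ =>
        A.wsum_blockWeight_truncPulls_le h0 h1 β j θ q ω
    _ ≤ ((K : ℝ) ^ m * (R.card * (1 + K / 16 + 64 * Δ ^ 2 * (q + 1)))) / K := by
        rw [le_div_iff₀ hK']; linarith
    _ = _ := by field_simp

/-- Summing the block estimates, the main terms add up to a multiple of `T` since the blocks
partition the rounds, and the truncation errors add up to at most `L * (B / (q + 1))` since the
queries add up to at most `B`. -/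
theorem sum_wsum_pulls_le (A : Algorithm Ω K T) (hK : 0 < K) {Δ : ℝ} (h0 : 0 ≤ Δ)
    (h1 : Δ ≤ 1 / 4) (β : Fin T → Fin m) (L : ℕ) (hL : ∀ j, (blockRounds β j).card ≤ L)
    (q B : ℕ) (ω : Ω) (hB : ∀ b, A.numQueries (ω, bitTable b) ≤ B) :
    ∑ θ : Fin m → Fin K, wsum (blockWeight Δ β θ)
        (fun b => ∑ t, if A.arm t (ω, bitTable b) = θ (β t) then 1 else 0)
      ≤ (K : ℝ) ^ m * (T * (1 / K + 1 / 16 + 64 * Δ ^ 2 * (q + 1) / K) + L * (B / (q + 1))) := by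
  have hpt : ∀ (θ : Fin m → Fin K) b,
      (∑ t, if A.arm t (ω, bitTable b) = θ (β t) then (1 : ℝ) else 0)
        ≤ ∑ j, A.truncPulls (blockRounds β j) q (θ j) ω b + L * (B / (q + 1)) := by
    intro θ b
    have e1 : (∑ t, if A.arm t (ω, bitTable b) = θ (β t) then (1 : ℝ) else 0)
        = ∑ j, (((blockRounds β j).filter fun s =>
            (A.decision s (ω, bitTable b)).1 = θ j).card : ℝ) := by
      rw [← Finset.sum_fiberwise (s := Finset.univ) (g := β)]
      refine Finset.sum_congr rfl fun j _ => ?_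
      rw [Finset.card_filter]
      push_cast
      refine Finset.sum_congr rfl fun t ht => ?_
      rw [(Finset.mem_filter.mp ht).2]
      rfl
    have e2 : ∑ j, (A.queriesIn (blockRounds β j) ω b : ℝ) ≤ B := by
      have : ∑ j, A.queriesIn (blockRounds β j) ω b = A.numQueries (ω, bitTable b) := by
        unfold numQueries
        rw [← Finset.sum_fiberwise (s := Finset.univ) (g := β)]
        refine Finset.sum_congr rfl fun j _ => ?_
        rw [queriesIn, Finset.card_filter]
        rfl
      exact_mod_cast this.le.trans (hB b)
    have e3 : ∑ j, ((blockRounds β j).card : ℝ) * (A.queriesIn (blockRounds β j) ω b / (q + 1))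
        ≤ L * (B / (q + 1)) := by
      calc _ ≤ ∑ j, (L : ℝ) * (A.queriesIn (blockRounds β j) ω b / (q + 1)) :=
            Finset.sum_le_sum fun j _ => by
              gcongr
              exact hL j
        _ = L * ((∑ j, (A.queriesIn (blockRounds β j) ω b : ℝ)) / (q + 1)) := by
            rw [← Finset.mul_sum, Finset.sum_div]
        _ ≤ _ := by gcongr
    rw [e1]
    refine (Finset.sum_le_sum fun j _ => A.pulls_le (blockRounds β j) q (θ j) ω b).trans ?_
    rw [Finset.sum_add_distrib]
    linarith
  have hw : ∀ θ : Fin m → Fin K, ∀ i, ∑ v, blockWeight Δ β θ i v = 1 := fun θ i =>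
    sum_coinWeight _
  have hw0 : ∀ (θ : Fin m → Fin K) i v, 0 ≤ blockWeight Δ β θ i v := fun θ i v => by
    refine coinWeight_nonneg ?_ ?_ v <;> split_ifs <;> linarith
  have hT : ∑ j, ((blockRounds β j).card : ℝ) = T := by
    have := Finset.card_eq_sum_card_fiberwise (s := (Finset.univ : Finset (Fin T)))
      (t := Finset.univ) (f := β) fun _ _ => Finset.mem_coe.mpr (Finset.mem_univ _)
    rw [Finset.card_univ, Fintype.card_fin] at this
    exact_mod_cast this.symm
  calc _ ≤ ∑ θ : Fin m → Fin K, (∑ j, wsum (blockWeight Δ β θ)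
          (A.truncPulls (blockRounds β j) q (θ j) ω) + L * (B / (q + 1))) := by
        refine Finset.sum_le_sum fun θ _ => (wsum_mono (hw0 θ) (hpt θ)).trans_eq ?_
        rw [wsum_add, wsum_sum, wsum_const (hw θ)]
    _ = ∑ j, ∑ θ : Fin m → Fin K, wsum (blockWeight Δ β θ)
          (A.truncPulls (blockRounds β j) q (θ j) ω) + (K : ℝ) ^ m * (L * (B / (q + 1))) := by
        rw [Finset.sum_add_distrib, Finset.sum_comm]
        simp
    _ ≤ ∑ j, (K : ℝ) ^ m * ((blockRounds β j).card
          * (1 / K + 1 / 16 + 64 * Δ ^ 2 * (q + 1) / K))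
          + (K : ℝ) ^ m * (L * (B / (q + 1))) := by
        gcongr with j
        exact A.sum_wsum_truncPulls_le hK h0 h1 β j q ω
    _ = _ := by
        rw [← Finset.mul_sum, ← Finset.sum_mul, hT]
        ring

end Algorithm

/-! ### Total variation of the block environments -/

/-- The means `1 / 2 + Δ` for arm `θ (β t)` in round `t` and `1 / 2` for the other arms. -/
noncomputable def blockMean {Δ : ℝ} (h0 : 0 ≤ Δ) (h1 : Δ ≤ 1 / 4) (β : Fin T → Fin m)
    (θ : Fin m → Fin K) (t : Fin T) (k : Fin K) : unitInterval :=
  ⟨1 / 2 + if k = θ (β t) then Δ else 0, by constructor <;> split_ifs <;> linarith⟩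

/-- Means change only when the block does. Bounding the change by the increment of the block index,
rather than by an indicator, makes the total variation telescope. -/
theorem abs_blockMean_sub_le {Δ : ℝ} (h0 : 0 ≤ Δ) (h1 : Δ ≤ 1 / 4) (β : Fin T → Fin m)
    (θ : Fin m → Fin K) {s t : Fin T} (hst : β s ≤ β t) (k : Fin K) :
    |(blockMean h0 h1 β θ t k : ℝ) - blockMean h0 h1 β θ s k|
      ≤ Δ * (((β t : ℕ) : ℝ) - (β s : ℕ)) := by
  rcases hst.eq_or_lt with h | h
  · simp [blockMean, h]
  · have h2 : (1 : ℝ) ≤ ((β t : ℕ) : ℝ) - (β s : ℕ) := by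
      rw [le_sub_iff_add_le, add_comm]
      exact_mod_cast Fin.lt_def.mp h
    refine le_trans ?_ (le_mul_of_one_le_right h0 h2)
    simp only [blockMean]
    rw [abs_le]
    constructor <;> split_ifs <;> linarith

theorem variation_coinEnv_blockMean_le (hK : 0 < K) (hm : 0 < m) {Δ : ℝ} (h0 : 0 ≤ Δ)
    (h1 : Δ ≤ 1 / 4) {β : Fin T → Fin m} (hβ : Monotone β) (θ : Fin m → Fin K) :
    (coinEnv (blockMean h0 h1 β θ)).variation ≤ Δ * (m - 1) := by
  have : Nonempty (Fin K) := ⟨⟨0, hK⟩⟩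
  have hm1 : (1 : ℝ) ≤ m := by exact_mod_cast hm
  rcases T with _ | T
  · simpa [Environment.variation] using mul_nonneg h0 (sub_nonneg.mpr hm1)
  -- `Fin.ofNat` extends `β` to all natural numbers, so that the telescoping sum can be taken over a
  -- range.
  have key : ∀ t : Fin (T + 1 - 1),
      (⨆ k, |(coinEnv (blockMean h0 h1 β θ)).mean ⟨t + 1, by omega⟩ k
        - (coinEnv (blockMean h0 h1 β θ)).mean ⟨t, by omega⟩ k|)
      ≤ (fun n : ℕ => Δ * (((β (Fin.ofNat (T + 1) (n + 1)) : ℕ) : ℝ)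
          - (β (Fin.ofNat (T + 1) n) : ℕ))) t := by
    intro t
    have e1 : Fin.ofNat (T + 1) ((t : ℕ) + 1) = ⟨t + 1, by omega⟩ :=
      Fin.ext (Nat.mod_eq_of_lt (by omega))
    have e2 : Fin.ofNat (T + 1) (t : ℕ) = ⟨t, by omega⟩ :=
      Fin.ext (Nat.mod_eq_of_lt (by omega))
    refine ciSup_le fun k => ?_
    simp only [coinEnv_mean, e1, e2]
    exact abs_blockMean_sub_le h0 h1 β θ (hβ (Fin.le_def.mpr (Nat.le_succ _))) k
  refine (Finset.sum_le_sum fun t _ => key t).trans ?_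
  rw [Fin.sum_univ_eq_sum_range (fun n : ℕ => Δ * (((β (Fin.ofNat (T + 1) (n + 1)) : ℕ) : ℝ)
          - (β (Fin.ofNat (T + 1) n) : ℕ))), ← Finset.mul_sum,
    Finset.sum_range_sub (fun n : ℕ => ((β (Fin.ofNat (T + 1) n) : ℕ) : ℝ))]
  refine mul_le_mul_of_nonneg_left ?_ h0
  have h2 : ((β (Fin.ofNat (T + 1) (T + 1 - 1)) : ℕ) : ℝ) + 1 ≤ m := by
    exact_mod_cast (β (Fin.ofNat (T + 1) (T + 1 - 1))).2
  have h3 : (0 : ℝ) ≤ ((β (Fin.ofNat (T + 1) 0) : ℕ) : ℝ) := Nat.cast_nonneg _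
  linarith

/-! ### Averaging over the hidden arms -/

namespace Algorithm

variable {Ω : Type u} [MeasurableSpace Ω]

theorem numQueries_le (A : Algorithm Ω K T) (p : Ω × RewardTable K T) : A.numQueries p ≤ T := by
  unfold numQueries
  calc _ ≤ ∑ _t : Fin T, 1 := Finset.sum_le_sum fun t _ => by split_ifs <;> simp
    _ = T := by simp

/-- For almost every seed the reward summed over all `θ` is bounded; integrating over the seed, some
`θ` does no better than the average. The budget enters as `min B T` because there are never more
than `T` queries, which matters when the blocks are as short as possible. -/
theorem exists_regret_ge (A : Algorithm Ω K T) (hK : 0 < K) {Δ : ℝ} (h0 : 0 ≤ Δ)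
    (h1 : Δ ≤ 1 / 4) (β : Fin T → Fin m) (L : ℕ) (hL : ∀ j, (blockRounds β j).card ≤ L)
    (q B : ℕ) (hB : A.Feasible B) :
    ∃ θ : Fin m → Fin K, Δ * (T - (T * (1 / K + 1 / 16 + 64 * Δ ^ 2 * (q + 1) / K)
      + L * ((min B T : ℕ) / (q + 1)))) ≤ A.regret (coinEnv (blockMean h0 h1 β θ)) := by
  have : Nonempty (Fin K) := ⟨⟨0, hK⟩⟩
  set C : ℝ := T * (1 / K + 1 / 16 + 64 * Δ ^ 2 * (q + 1) / K)
      + L * ((min B T : ℕ) / (q + 1)) with hC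
  set M : (Fin m → Fin K) → Ω → ℝ := fun θ ω => wsum (blockWeight Δ β θ)
    fun b => ∑ t, (blockMean h0 h1 β θ t (A.arm t (ω, bitTable b)) : ℝ) with hM
  have hMI : ∀ θ, Integrable (M θ) (A.seedLaw : Measure Ω) ∧
      ∫ x, ∑ t, (coinEnv (blockMean h0 h1 β θ)).mean t (A.arm t x)
        ∂(A.sampleLaw (coinEnv (blockMean h0 h1 β θ))) = ∫ ω, M θ ω ∂(A.seedLaw : Measure Ω) :=
    fun θ => A.integrable_wsum_mean_arm (blockMean h0 h1 β θ)
  have hMG : ∀ θ ω, M θ ω = T / 2 + Δ * wsum (blockWeight Δ β θ)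
      (fun b => ∑ t, if A.arm t (ω, bitTable b) = θ (β t) then 1 else 0) := by
    intro θ ω
    rw [← wsum_const_mul, ← wsum_const (w := blockWeight Δ β θ) (fun i => sum_coinWeight _)
      ((T : ℝ) / 2), ← wsum_add]
    simp only [hM]
    congr 1; funext b
    simp only [blockMean, Finset.sum_add_distrib, Finset.mul_sum, mul_ite, mul_one, mul_zero]
    congr 1
    simp [div_eq_mul_inv]
  have hae : ∀ᵐ ω ∂(A.seedLaw : Measure Ω), ∑ θ, M θ ω ≤ (K : ℝ) ^ m * (T / 2 + Δ * C) := by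
    -- Feasibility in one environment suffices, since it bounds the queries on every binary table;
    -- the constant `θ` is an arbitrary choice.
    have hq := A.ae_numQueries_bitTable_le hB
      (blockMean h0 h1 β fun _ => (⟨0, hK⟩ : Fin K))
      (fun t k => by simp only [blockMean]; split_ifs <;> linarith)
      (fun t k => by simp only [blockMean]; split_ifs <;> linarith)
    filter_upwards [hq] with ω hω
    have h := A.sum_wsum_pulls_le hK h0 h1 β L hL q (min B T) ω
      fun b => le_min (hω b) (A.numQueries_le _)
    simp only [hMG, Finset.sum_add_distrib, ← Finset.mul_sum]
    have h' := mul_le_mul_of_nonneg_left h h0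
    rw [← hC] at h'
    simp only [Finset.sum_const, Finset.card_univ, Fintype.card_fun, Fintype.card_fin,
      nsmul_eq_mul, Nat.cast_pow]
    linarith
  have hint : ∑ θ, ∫ ω, M θ ω ∂(A.seedLaw : Measure Ω)
      ≤ ∑ _θ : Fin m → Fin K, ((T : ℝ) / 2 + Δ * C) := by
    rw [← integral_finsetSum _ fun θ _ => (hMI θ).1]
    calc _ ≤ ∫ _ω, (K : ℝ) ^ m * (T / 2 + Δ * C) ∂(A.seedLaw : Measure Ω) :=
          integral_mono_ae (integrable_finsetSum _ fun θ _ => (hMI θ).1) (integrable_const _) hae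
      _ = _ := by simp [mul_add]
  obtain ⟨θ, -, hθ⟩ := Finset.exists_le_of_sum_le Finset.univ_nonempty hint
  refine ⟨θ, ?_⟩
  have hbest : (T : ℝ) * (1 / 2 + Δ)
      ≤ ∑ t, (coinEnv (blockMean h0 h1 β θ)).bestMean t := by
    calc (T : ℝ) * (1 / 2 + Δ) = ∑ _t : Fin T, (1 / 2 + Δ) := by simp [mul_add]
      _ ≤ _ := Finset.sum_le_sum fun t _ => by
        refine le_trans (le_of_eq ?_) (le_ciSup (Set.finite_range _).bddAbove (θ (β t)))
        simp [coinEnv_mean, blockMean]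
  rw [regret, (hMI θ).2]
  linarith

end Algorithm

/-! ### Choice of parameters -/

theorem card_blockRounds_div_le {T m L : ℕ} (hL : 0 < L) (hT : ∀ t : Fin T, (t : ℕ) / L < m)
    (j : Fin m) : (blockRounds (fun t : Fin T => (⟨t / L, hT t⟩ : Fin m)) j).card ≤ L := by
  have h := Finset.card_le_card_of_injOn (s := blockRounds (fun t : Fin T =>
    (⟨t / L, hT t⟩ : Fin m)) j) (t := Finset.range L) (fun t : Fin T => (t : ℕ) % L)
    (fun t _ => Finset.mem_coe.mpr (Finset.mem_range.mpr (Nat.mod_lt _ hL)))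
    (fun s hs t ht hst => by
      simp only [blockRounds, Finset.coe_filter, Set.mem_ofPred_eq, Finset.mem_univ, true_and,
        Fin.ext_iff] at hs ht
      refine Fin.ext ?_
      rw [← Nat.div_add_mod s L, ← Nat.div_add_mod t L, hs, ht]
      simp only at hst
      rw [hst])
  simpa using h

/-- The fraction of rounds playing the hidden arm is at most `1/2 + 1/16 + 1/16 + 1/8 = 3/4`:
guessing, the constant `a`, information, and truncation. With `Δ = y / 200` the remaining quarter
gives `1/800`. -/
theorem Algorithm.le_dynamicRegret {Ω : Type u} [MeasurableSpace Ω] {K T B m : ℕ} {V y : ℝ}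
    (A : Algorithm Ω K T) (hA : A.Feasible B) (hK : 2 ≤ K) (hm : 0 < m) (hmT : m ≤ T)
    (hy0 : 0 ≤ y) (hy1 : y ≤ 1) (hyV : y * (m - 1) ≤ V)
    (hyB : (min B T : ℕ) * y ^ 2 ≤ K * m) : 1 / 800 * (y * T) ≤ A.dynamicRegret V := by
  set Δ := y / 200 with hΔ
  have h0 : 0 ≤ Δ := by positivity
  have h1 : Δ ≤ 1 / 4 := by rw [hΔ]; linarith
  -- Rounding up ensures that `m` blocks of this length cover all rounds, and `m ≤ T` keeps `L * m ≤
  -- 2 * T`.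
  set L := T / m + 1 with hL
  have hdiv : ∀ t : Fin T, (t : ℕ) / L < m := fun t => by
    rw [Nat.div_lt_iff_lt_mul (Nat.succ_pos _)]
    exact t.2.trans (Nat.lt_mul_div_succ T hm)
  set β : Fin T → Fin m := fun t => ⟨t / L, hdiv t⟩ with hβ
  have hmono : Monotone β := fun s t h => Fin.le_def.mpr (Nat.div_le_div_right h)
  set B' := min B T
  -- Sixteen times the average number of queries per block, so the truncation loses at most `L * m /
  -- 16 ≤ T / 8` rounds.
  set q := 16 * B' / m with hq
  obtain ⟨θ, hθ⟩ := A.exists_regret_ge (by omega) h0 h1 β L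
    (card_blockRounds_div_le (Nat.succ_pos _) hdiv) q B hA
  have hm1 : (1 : ℝ) ≤ m := by exact_mod_cast hm
  have hm0 : (0 : ℝ) < m := by linarith
  have hK2 : (2 : ℝ) ≤ K := by exact_mod_cast hK
  have hT0 : (0 : ℝ) ≤ T := Nat.cast_nonneg _
  have hmT' : (m : ℝ) ≤ T := by exact_mod_cast hmT
  have hvar : (coinEnv (blockMean h0 h1 β θ)).variation ≤ V := by
    refine (variation_coinEnv_blockMean_le (by omega) hm h0 h1 hmono θ).trans (le_trans ?_ hyV)
    refine mul_le_mul_of_nonneg_right ?_ (by linarith)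
    rw [hΔ]; linarith
  have hreg : A.regret (coinEnv (blockMean h0 h1 β θ)) ≤ A.dynamicRegret V :=
    le_ciSup (A.bddAbove_regret V) ⟨_, hvar⟩
  refine le_trans ?_ (hθ.trans hreg)
  have hq1 : (16 * B' : ℝ) ≤ m * (q + 1) := by
    exact_mod_cast (Nat.lt_mul_div_succ (16 * B') hm).le
  have hq2 : (q : ℝ) * m ≤ 16 * B' := by
    exact_mod_cast Nat.div_mul_le_self (16 * B') m
  have hLm : (L : ℝ) * m ≤ 2 * T := by
    have : (((T / m : ℕ) : ℝ)) * m ≤ T := by exact_mod_cast Nat.div_mul_le_self T m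
    rw [hL]; push_cast; linarith
  have c1 : (1 : ℝ) / K ≤ 1 / 2 := one_div_le_one_div_of_le (by norm_num) hK2
  have c2 : 64 * Δ ^ 2 * (q + 1) / K ≤ 1 / 16 := by
    rw [div_le_iff₀ (by linarith)]
    have hy2 : y ^ 2 ≤ 1 := by nlinarith
    have d1 : y ^ 2 * q ≤ 16 * K := by
      have e1 : y ^ 2 * (q * m) ≤ y ^ 2 * (16 * B') :=
        mul_le_mul_of_nonneg_left hq2 (sq_nonneg y)
      have e2 : (y ^ 2 * q) * m ≤ (16 * K) * m := by linarith
      exact le_of_mul_le_mul_right e2 hm0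
    rw [hΔ, show 64 * (y / 200) ^ 2 * ((q : ℝ) + 1) = (y ^ 2 * q + y ^ 2) / 625 by ring]
    linarith
  have c3 : (L : ℝ) * (B' / (q + 1)) ≤ T / 8 := by
    rw [← mul_div_assoc, div_le_iff₀ (by positivity)]
    have e1 : (L : ℝ) * m * (16 * B') ≤ 2 * T * (m * (q + 1)) :=
      mul_le_mul hLm hq1 (by positivity) (by positivity)
    have e2 : (L * B' : ℝ) * (16 * m) ≤ (T / 8 * (q + 1)) * (16 * m) := by linarith
    exact le_of_mul_le_mul_right e2 (by positivity)
  have c4 := mul_le_mul_of_nonneg_left (add_le_add (add_le_add_left c1 (1 / 16)) c2) hT0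
  have c5 : (T : ℝ) / 4 ≤ T - (T * (1 / K + 1 / 16 + 64 * Δ ^ 2 * (q + 1) / K)
      + L * (B' / (q + 1))) := by linarith
  calc 1 / 800 * (y * T) = Δ * (T / 4) := by rw [hΔ]; ring
    _ ≤ _ := mul_le_mul_of_nonneg_left c5 h0

theorem Algorithm.dynamicRegret_nonneg_of_horizon_zero {Ω : Type u} [MeasurableSpace Ω] {K : ℕ}
    (A : Algorithm Ω K 0) {V : ℝ} (hV : 0 ≤ V) : 0 ≤ A.dynamicRegret V := by
  have h0 : A.regret (fun t => t.elim0) = 0 := by simp [Algorithm.regret]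
  rw [← h0]
  exact le_ciSup (A.bddAbove_regret V) ⟨fun t => t.elim0, by simpa [Environment.variation]⟩

end ConstrainedBandit

theorem mainTheorem2 :
    ∃ c : ℝ, 0 < c ∧
      ∀ (K T B : ℕ) (V : ℝ), 2 ≤ K → K ≤ B → (K : ℝ)⁻¹ ≤ V → V ≤ (K : ℝ)⁻¹ * B →
        ∀ (Ω : Type u) [MeasurableSpace Ω] (A : ConstrainedBandit.Algorithm Ω K T),
          A.Feasible B →
            c * ((K : ℝ) ^ (1 / 3 : ℝ) * V ^ (1 / 3 : ℝ) * T / (B : ℝ) ^ (1 / 3 : ℝ))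
              ≤ A.dynamicRegret V := by
  refine ⟨1 / 800, by norm_num, ?_⟩
  intro K T B V hK hKB hV1 hV2 Ω _ A hA
  have hK0 : (0 : ℝ) < K := by exact_mod_cast (by omega : 0 < K)
  have hB0 : (0 : ℝ) < B := by exact_mod_cast (by omega : 0 < B)
  have hV0 : 0 < V := (inv_pos.mpr hK0).trans_le hV1
  have hcube : ∀ z : ℝ, 0 < z → (z ^ (1 / 3 : ℝ)) ^ 3 = z := fun z hz => by
    rw [← Real.rpow_natCast, ← Real.rpow_mul hz.le]; norm_num
  -- An empty horizon admits no block count with `0 < m ≤ T`, so it is treated apart.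
  rcases Nat.eq_zero_or_pos T with rfl | hT
  · simpa using A.dynamicRegret_nonneg_of_horizon_zero hV0.le
  have hk := hcube K hK0
  have hv := hcube V hV0
  have hb := hcube B hB0
  have hk0 := Real.rpow_pos_of_pos hK0 (1 / 3)
  have hv0 := Real.rpow_pos_of_pos hV0 (1 / 3)
  have hb0 := Real.rpow_pos_of_pos hB0 (1 / 3)
  set k := (K : ℝ) ^ (1 / 3 : ℝ)
  set v := V ^ (1 / 3 : ℝ)
  set b := (B : ℝ) ^ (1 / 3 : ℝ)
  -- The pair `y = (K V / B) ^ (1/3)`, `x = (V ^ 2 B / K) ^ (1/3)` solves `y * x = V` and `B * y ^ 2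
  -- = K * x`, which balances the variation and information constraints. The block count is `min T
  -- (⌊x⌋₊ + 1)`: at most `x + 1` for the variation, which sees `m - 1`.
  set y := k * v / b with hy
  set x := v ^ 2 * b / k with hx
  have hy0 : 0 < y := by positivity
  have hx0 : 0 < x := by positivity
  have hxy : y * x = V := by rw [← hv, hx, hy]; field_simp
  have hByx : (B : ℝ) * y ^ 2 = K * x := by rw [← hb, ← hk, hx, hy]; field_simp
  have hy1 : y ≤ 1 := by
    have h3 : y ^ 3 ≤ 1 := by
      rw [hy, div_pow, mul_pow, hk, hv, hb, div_le_one hB0]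
      rw [inv_mul_eq_div, le_div_iff₀ hK0] at hV2
      linarith
    by_contra h
    exact absurd h3 (not_le.mpr (one_lt_pow₀ (not_le.mp h) (by norm_num)))
  have hyV : y * (((min T (⌊x⌋₊ + 1) : ℕ) : ℝ) - 1) ≤ V := by
    rw [← hxy]
    refine mul_le_mul_of_nonneg_left ?_ hy0.le
    have h1 : ((min T (⌊x⌋₊ + 1) : ℕ) : ℝ) ≤ ⌊x⌋₊ + 1 := by exact_mod_cast min_le_right _ _
    have h2 := Nat.floor_le hx0.le
    linarith
  have hyB : ((min B T : ℕ) : ℝ) * y ^ 2 ≤ K * (min T (⌊x⌋₊ + 1) : ℕ) := by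
    -- If the block count is capped at `T`, the information constraint follows from having at most
    -- `T` queries and `y ≤ 1`; otherwise it follows from `x < ⌊x⌋₊ + 1`.
    rcases le_total T (⌊x⌋₊ + 1) with h | h
    · rw [min_eq_left h]
      have h1 : ((min B T : ℕ) : ℝ) ≤ T := by exact_mod_cast min_le_right _ _
      have h2 : y ^ 2 ≤ 1 := pow_le_one₀ hy0.le hy1
      have h3 : (1 : ℝ) ≤ K := by exact_mod_cast (by omega : 1 ≤ K)
      calc _ ≤ (T : ℝ) * 1 := mul_le_mul h1 h2 (sq_nonneg y) (Nat.cast_nonneg _)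
        _ ≤ K * T := by nlinarith [(Nat.cast_nonneg T : (0 : ℝ) ≤ T)]
    · rw [min_eq_right h]
      have h1 : ((min B T : ℕ) : ℝ) ≤ B := by exact_mod_cast min_le_left _ _
      calc _ ≤ (B : ℝ) * y ^ 2 := mul_le_mul_of_nonneg_right h1 (sq_nonneg y)
        _ = K * x := hByx
        _ ≤ _ := by
          refine mul_le_mul_of_nonneg_left ?_ hK0.le
          push_cast
          exact (Nat.lt_floor_add_one x).le
  have h := A.le_dynamicRegret hA hK (lt_min hT (Nat.succ_pos _)) (min_le_left _ _) hy0.le hy1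
    hyV hyB
  rwa [show k * v * T / b = y * T by rw [hy]; ring]
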